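/- Call a subset $X$ of a group product-free if there are no $x,y,z\in X$ (not necessarily distinct) with $xy=z$. Let $q$ be a prime power, let $\Gamma=\mathrm{PSL}_2(q)$ be the group of $2\times 2$ matrices of determinant $1$ over the field with $q$ elements modulo the subgroup $\{I,-I\}$, and let $n=|\Gamma|$. Then $\Gamma$ has no product-free subset of cardinality greater than $2n^{8/9}$. Consequently, the question of Babai and Sós has a negative answer: there is no constant $c>0$ such that every non-trivial finite group $G$ has a product-free subset of size at least $c|G|$. -/

import Mathlib

/-- A subset `X` of a group is product-free if there are no `x, y, z ∈ X` (not necessarily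
distinct) with `x * y = z`. -/
def IsProductFree {G : Type*} [Group G] (X : Set G) : Prop :=
  ∀ x ∈ X, ∀ y ∈ X, ∀ z ∈ X, x * y ≠ z

/-! Gowers' argument: put `n = |G|`, let `X` be product-free of size `m`, and let `T` average left
translates with weight `1_X - m/n`. Product-freeness forces `⟪1_X, T 1_X⟫ = -m³/n`, so the top
eigenvalue `μ` of `T*T` is at least `m⁴/n²`. Its eigenspace is stable under right translation and,
as `T` kills constants, has no nonzero invariants, so its dimension is at least `d`; the
Hilbert–Schmidt bound `dim · μ ≤ n m` then gives `d m³ ≤ n³`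
(`IsProductFree.mul_card_pow_three_le`). For `PSL₂(q)`, `card_sub_one_le_two_mul_finrank` allows `d
= ⌊q/2⌋`, of order `n^{1/3}`. -/

/-! ### Degrees of nontrivial representations of `SL₂(q)` -/

section UnipotentCharacters

open Matrix Matrix.SpecialLinearGroup

/-- A vector that is moved by some element of a finite abelian group has a nonzero component in an
isotypic part for a nontrivial character. -/
theorem exists_nontrivial_character_vector {A W : Type*} [AddCommGroup A] [Finite A]
    [AddCommGroup W] [Module ℂ W] (ρ : Multiplicative A →* Module.End ℂ W) (E : Submodule ℂ W)
    (hE : ∀ a, ∀ v ∈ E, ρ a v ∈ E) {v : W} (hv : v ∈ E) {a : A}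
    (ha : ρ (Multiplicative.ofAdd a) v ≠ v) :
    ∃ ψ : AddChar A ℂ, ψ ≠ 0 ∧ ∃ w ∈ E, w ≠ 0 ∧
      ∀ x, ρ (Multiplicative.ofAdd x) w = ψ x • w := by
  classical
  have := Fintype.ofFinite A
  -- Unnormalised projection to the `ψ`-part. These sum to `|A| v`; were only the trivial one
  -- nonzero, `v` would be fixed.
  let P (ψ : AddChar A ℂ) : W := ∑ x, ψ (-x) • ρ (Multiplicative.ofAdd x) v
  have hP (ψ : AddChar A ℂ) (y : A) : ρ (Multiplicative.ofAdd y) (P ψ) = ψ y • P ψ := by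
    simp only [P, map_sum, map_smul, Finset.smul_sum, smul_smul]
    refine Fintype.sum_equiv (Equiv.addLeft y) _ _ fun x => ?_
    have h1 : ψ (-x) = ψ y * ψ (-(y + x)) := by
      rw [← AddChar.map_add_eq_mul]; congr 1; abel
    rw [Equiv.coe_addLeft, h1, ofAdd_add, map_mul]
    rfl
  by_contra! hcon
  have h0 (ψ : AddChar A ℂ) (hψ : ψ ≠ 0) : P ψ = 0 := by
    by_contra hne
    obtain ⟨x, hx⟩ := hcon ψ hψ (P ψ)
      (E.sum_mem fun x _ => E.smul_mem _ (hE _ _ hv)) hne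
    exact hx (hP ψ x)
  have hsum : ∑ ψ, P ψ = (Fintype.card A : ℂ) • v := by
    simp only [P]
    rw [Finset.sum_comm]
    simp_rw [← Finset.sum_smul, AddChar.sum_apply_eq_ite, neg_eq_zero]
    simp
  rw [Fintype.sum_eq_single 0 h0] at hsum
  have h2 := hP 0 a
  rw [hsum, AddChar.zero_apply, one_smul, map_smul] at h2
  exact ha (smul_right_injective W
    (Nat.cast_ne_zero.2 Fintype.card_ne_zero : (Fintype.card A : ℂ) ≠ 0) h2)

/-- Simultaneous eigenvectors of a finite abelian group for distinct characters are linearly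
independent. -/
theorem linearIndependent_of_characters {A W ι : Type*} [AddCommGroup A] [Finite A]
    [AddCommGroup W] [Module ℂ W] (ρ : A → Module.End ℂ W) (ψ : ι → AddChar A ℂ)
    (hψ : Function.Injective ψ) (w : ι → W) (hw : ∀ i, w i ≠ 0)
    (h : ∀ i x, ρ x (w i) = ψ i x • w i) : LinearIndependent ℂ w := by
  classical
  have := Fintype.ofFinite A
  rw [linearIndependent_iff']
  intro s c hc j hj
  have h1 : ∑ x, ψ j (-x) • ρ x (∑ i ∈ s, c i • w i) = 0 := by simp [hc]
  have h2 (i : ι) : ∑ x, ψ j (-x) * ψ i x = if i = j then (Fintype.card A : ℂ) else 0 := by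
    have := AddChar.sum_eq_ite (ψ i - ψ j)
    simp only [AddChar.sub_apply, sub_eq_zero, hψ.eq_iff] at this
    rw [← this]
    exact Finset.sum_congr rfl fun x _ => mul_comm _ _
  simp only [map_sum, map_smul, h, Finset.smul_sum, smul_smul] at h1
  rw [Finset.sum_comm] at h1
  have h3 (i : ι) : ∑ x, (ψ j (-x) * (c i * ψ i x)) • w i =
      (c i * if i = j then (Fintype.card A : ℂ) else 0) • w i := by
    rw [← h2, ← Finset.sum_smul, Finset.mul_sum]
    congr 1
    exact Finset.sum_congr rfl fun x _ => by ring
  simp only [h3] at h1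
  rw [Finset.sum_eq_single_of_mem j hj fun i _ hi => by simp [hi]] at h1
  simpa [hw j] using h1

variable {F : Type*} [Field F]

/-- Through this relation the torus carries a `ψ`-eigenvector of the unipotent group to one for `x ↦
ψ (t² x)`. -/
theorem transvection_mul_diag2 {t : F} (ht : t ≠ 0) (x : F) :
    transvection (zero_ne_one : (0 : Fin 2) ≠ 1) x * diag2 t⁻¹ (inv_ne_zero ht) =
      diag2 t⁻¹ (inv_ne_zero ht) * transvection zero_ne_one (t ^ 2 * x) := by
  ext i j
  fin_cases i <;> fin_cases j <;>
    simp [transvection_coe, diag2_coe, Matrix.single, Matrix.mul_apply, Fin.sum_univ_two]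
  field_simp

/-- A normal subgroup of `SL₂(F)` containing the upper unitriangular matrices is everything. -/
theorem normal_eq_top_of_transvection_mem (N : Subgroup (SpecialLinearGroup (Fin 2) F)) [N.Normal]
    (hN : ∀ x : F, transvection (zero_ne_one : (0 : Fin 2) ≠ 1) x ∈ N) : N = ⊤ := by
  let s : SpecialLinearGroup (Fin 2) F := ⟨!![0, 1; -1, 0], by simp [Matrix.det_fin_two_of]⟩
  have hl (x : F) : transvection (one_ne_zero : (1 : Fin 2) ≠ 0) x ∈ N := by
    have := ‹N.Normal›.conj_mem _ (hN (-x)) s⁻¹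
    convert this using 1
    rw [inv_inv, eq_comm, mul_assoc, inv_mul_eq_iff_eq_mul]
    ext i j
    rw [Matrix.SpecialLinearGroup.coe_mul, Matrix.SpecialLinearGroup.coe_mul]
    fin_cases i <;> fin_cases j <;>
      simp [s, transvection_coe, Matrix.single, Matrix.mul_apply, Fin.sum_univ_two]
  -- Off the Borel subgroup, every element factors as upper, lower, upper unitriangular.
  have key (g : SpecialLinearGroup (Fin 2) F) (hg : g.1 1 0 ≠ 0) : g ∈ N := by
    have hdet : g.1 0 0 * g.1 1 1 - g.1 0 1 * g.1 1 0 = 1 := by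
      rw [← Matrix.det_fin_two]; exact g.2
    have : g = transvection zero_ne_one ((g.1 0 0 - 1) / g.1 1 0) *
        transvection one_ne_zero (g.1 1 0) *
        transvection zero_ne_one ((g.1 1 1 - 1) / g.1 1 0) := by
      ext i j
      fin_cases i <;> fin_cases j <;>
        simp [transvection_coe, Matrix.single, Matrix.mul_apply, Fin.sum_univ_two] <;>
        field_simp <;> first | ring1 | linear_combination -hdet
    rw [this]
    exact N.mul_mem (N.mul_mem (hN _) (hl _)) (hN _)
  rw [eq_top_iff]
  intro g _
  by_cases hg : g.1 1 0 = 0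
  · have hdet : g.1 0 0 * g.1 1 1 - g.1 0 1 * g.1 1 0 = 1 := by
      rw [← Matrix.det_fin_two]; exact g.2
    have h0 : g.1 0 0 ≠ 0 := by
      rintro h; simp [h, hg] at hdet
    refine (N.mul_mem_cancel_left (hl 1)).1 (key _ ?_)
    simpa [transvection_coe, Matrix.single, Matrix.mul_apply, Fin.sum_univ_two, hg] using h0
  · exact key g hg

/-- A finite field with `q` elements has at least `(q - 1) / 2` nonzero squares. -/
theorem card_le_two_mul_card_squares [Fintype F] [DecidableEq F] :
    Fintype.card F - 1 ≤ 2 * ((Finset.univ.erase (0 : F)).image (· ^ 2)).card := by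
  rw [← Finset.card_univ, ← Finset.card_erase_of_mem (Finset.mem_univ (0 : F))]
  refine Finset.card_le_mul_card_image _ 2 fun b hb => ?_
  obtain ⟨y, -, rfl⟩ := Finset.mem_image.1 hb
  refine (Finset.card_le_card (t := {y, -y}) fun x hx => ?_).trans Finset.card_le_two
  simpa using sq_eq_sq_iff_eq_or_eq_neg.1 (Finset.mem_filter.1 hx).2

/-- Frobenius: a nontrivial complex representation of `SL₂(q)` has degree at least
`(q - 1) / 2`. -/
theorem card_sub_one_le_two_mul_finrank [Finite F] {W : Type*} [AddCommGroup W] [Module ℂ W]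
    [FiniteDimensional ℂ W] (ρ : SpecialLinearGroup (Fin 2) F →* Module.End ℂ W)
    (E : Submodule ℂ W) (hE : ∀ g, ∀ v ∈ E, ρ g v ∈ E) (hne : ∃ g, ∃ v ∈ E, ρ g v ≠ v) :
    Nat.card F - 1 ≤ 2 * Module.finrank ℂ E := by
  classical
  have := Fintype.ofFinite F
  let u : Multiplicative F →* SpecialLinearGroup (Fin 2) F :=
    { toFun := fun x => transvection zero_ne_one x.toAdd
      map_one' := transvection_coeff_zero _
      map_mul' := fun x y => transvection_add _ _ _ }
  let N : Subgroup (SpecialLinearGroup (Fin 2) F) :=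
    { carrier := {g | ∀ v ∈ E, ρ g v = v}
      one_mem' := by simp
      mul_mem' := fun {g h} hg hh v hv => by
        rw [map_mul, Module.End.mul_apply, hh v hv, hg v hv]
      inv_mem' := fun {g} hg v hv => by
        conv_lhs => rw [← hg v hv]
        rw [← Module.End.mul_apply, ← map_mul]; simp }
  have : N.Normal := ⟨fun n hn g v hv => by
    rw [map_mul, map_mul, Module.End.mul_apply, Module.End.mul_apply, hn _ (hE _ _ hv),
      ← Module.End.mul_apply, ← map_mul]
    simp⟩
  obtain ⟨x, v, hv, hx⟩ : ∃ x : F, ∃ v ∈ E, ρ (u (Multiplicative.ofAdd x)) v ≠ v := by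
    by_contra! hcon
    obtain ⟨g, v, hv, hg⟩ := hne
    have : g ∈ N := by
      rw [normal_eq_top_of_transvection_mem N fun x => hcon x]
      exact Subgroup.mem_top g
    exact hg (this v hv)
  obtain ⟨ψ, hψ, w, hwE, hw, hρ⟩ :=
    exists_nontrivial_character_vector (ρ.comp u) E (fun a v hv => hE _ _ hv) hv hx
  set S := (Finset.univ.erase (0 : F)).image (· ^ 2) with hS
  have hs (a : S) : ∃ t : F, t ≠ 0 ∧ t ^ 2 = a := by
    obtain ⟨t, ht, hta⟩ := Finset.mem_image.1 a.2
    exact ⟨t, by simpa using ht, hta⟩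
  choose t ht hta using hs
  let y (a : S) : E := ⟨ρ (diag2 (t a)⁻¹ (inv_ne_zero (ht a))) w, hE _ _ hwE⟩
  have hli : LinearIndependent ℂ (fun a => (y a : W)) := by
    refine linearIndependent_of_characters (fun x => ρ (u (Multiplicative.ofAdd x)))
      (fun a : S => ψ.mulShift (a : F)) (fun a b hab => ?_) (fun a => (y a : W)) (fun a h0 => hw ?_) fun a x => ?_
    · by_contra hne
      refine hψ (DFunLike.ext _ _ fun x => ?_)
      have hsub : (a : F) - b ≠ 0 := sub_ne_zero.2 fun h => hne (Subtype.ext h)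
      have := DFunLike.congr_fun hab (x / ((a : F) - b))
      simp only [AddChar.mulShift_apply] at this
      have hx : x = a * (x / ((a : F) - b)) - b * (x / ((a : F) - b)) := by field_simp
      rw [hx, AddChar.map_sub_eq_div, this, div_self (ψ.val_isUnit _).ne_zero]
      simp
    · have := congrArg (ρ (diag2 (t a)⁻¹ (inv_ne_zero (ht a)))⁻¹) h0
      simpa [y, ← Module.End.mul_apply, ← map_mul] using this
    · change (ρ (transvection zero_ne_one x)) (ρ _ w) = _
      rw [← Module.End.mul_apply, ← map_mul, transvection_mul_diag2 (ht a), map_mul,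
        Module.End.mul_apply, hta]
      have := hρ (a * x)
      change ρ (transvection zero_ne_one (a * x)) w = _ at this
      rw [this, map_smul]
      rfl
  have hli' : LinearIndependent ℂ y := LinearIndependent.of_comp E.subtype hli
  have := hli'.fintype_card_le_finrank
  rw [Fintype.card_coe] at this
  have h2 := card_le_two_mul_card_squares (F := F)
  rw [← hS] at h2
  rw [Nat.card_eq_fintype_card]
  omega

end UnipotentCharacters

/-! ### Gowers' bound for product-free sets -/

section Quasirandom

open scoped InnerProductSpace

/-- The largest squared singular value of an operator is an eigenvalue of `T* T`. -/
theorem exists_top_singular_value {V : Type*} [NormedAddCommGroup V] [InnerProductSpace ℂ V]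
    [FiniteDimensional ℂ V] [Nontrivial V] (T : V →ₗ[ℂ] V) :
    ∃ μ : ℝ, Module.End.eigenspace (LinearMap.adjoint T ∘ₗ T) (μ : ℂ) ≠ ⊥ ∧
      ∀ f, ‖T f‖ ^ 2 ≤ μ * ‖f‖ ^ 2 := by
  have hre (x : V) : RCLike.re ⟪(LinearMap.adjoint T ∘ₗ T) x, x⟫_ℂ = ‖T x‖ ^ 2 := by
    rw [LinearMap.comp_apply, LinearMap.adjoint_inner_left, inner_self_eq_norm_sq]
  have hsymm : (LinearMap.adjoint T ∘ₗ T).IsSymmetric := fun x y => by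
    simp [LinearMap.adjoint_inner_left, LinearMap.adjoint_inner_right]
  refine ⟨_, hsymm.hasEigenvalue_iSup_of_finiteDimensional, fun f => ?_⟩
  rcases eq_or_ne f 0 with rfl | hf
  · simp
  have hpos : 0 < ‖f‖ ^ 2 := by positivity
  rw [← div_le_iff₀ hpos, ← hre]
  refine le_ciSup (f := fun x : {x : V // x ≠ 0} =>
    RCLike.re ⟪(LinearMap.adjoint T ∘ₗ T) x, x⟫_ℂ / ‖(x : V)‖ ^ 2) ?_ ⟨f, hf⟩
  -- The supremum of Rayleigh quotients is meaningful only once they are bounded.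
  refine ⟨‖T.toContinuousLinearMap‖ ^ 2, ?_⟩
  rintro _ ⟨⟨x, hx⟩, rfl⟩
  have hx' : 0 < ‖x‖ ^ 2 := by positivity
  simp only [hre]
  rw [div_le_iff₀ hx', ← mul_pow]
  gcongr
  exact T.toContinuousLinearMap.le_opNorm x

variable {G : Type*} [Group G]

/-- The right regular representation of a finite group on its complex-valued functions. -/
def rightRegular : G →* Module.End ℂ (EuclideanSpace ℂ G) where
  toFun g :=
    { toFun := fun f => WithLp.toLp 2 fun x => f (x * g)
      map_add' := fun _ _ => rfl
      map_smul' := fun _ _ => rfl }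
  map_one' := by ext; simp
  map_mul' g h := LinearMap.ext fun f => PiLp.ext fun x =>
    congrArg f (mul_assoc x g h).symm

theorem rightRegular_apply (g : G) (f : EuclideanSpace ℂ G) (x : G) :
    rightRegular g f x = f (x * g) := rfl

variable [Fintype G]

theorem inner_rightRegular (g : G) (f h : EuclideanSpace ℂ G) :
    ⟪rightRegular g f, rightRegular g h⟫_ℂ = ⟪f, h⟫_ℂ := by
  simp only [PiLp.inner_apply, rightRegular_apply]
  exact Fintype.sum_equiv (Equiv.mulRight g) _ _ fun x => rfl

/-- The average of left translations of a function, weighted by `w`. -/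
def weightedTranslate (w : G → ℂ) : EuclideanSpace ℂ G →ₗ[ℂ] EuclideanSpace ℂ G where
  toFun f := WithLp.toLp 2 fun x => ∑ a, w a * f (a * x)
  map_add' f g := by ext; simp [mul_add, Finset.sum_add_distrib]
  map_smul' c f := by ext; simp [Finset.mul_sum, mul_left_comm]

theorem weightedTranslate_apply (w : G → ℂ) (f : EuclideanSpace ℂ G) (x : G) :
    weightedTranslate w f x = ∑ a, w a * f (a * x) := rfl

theorem weightedTranslate_rightRegular (w : G → ℂ) (g : G) (f : EuclideanSpace ℂ G) :
    weightedTranslate w (rightRegular g f) = rightRegular g (weightedTranslate w f) := by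
  ext x
  simp [weightedTranslate_apply, rightRegular_apply, mul_assoc]

/-- Left and right translations commute and the latter are unitary; hence eigenspaces of `T*T` are
subrepresentations. -/
theorem adjoint_comp_rightRegular (w : G → ℂ) (g : G) (f : EuclideanSpace ℂ G) :
    (LinearMap.adjoint (weightedTranslate w) ∘ₗ weightedTranslate w) (rightRegular g f) =
      rightRegular g ((LinearMap.adjoint (weightedTranslate w) ∘ₗ weightedTranslate w) f) := by
  refine ext_inner_right ℂ fun h => ?_
  obtain ⟨h, rfl⟩ : ∃ h', rightRegular g h' = h :=
    ⟨rightRegular g⁻¹ h, by rw [← Module.End.mul_apply, ← map_mul]; simp⟩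
  rw [inner_rightRegular, LinearMap.comp_apply, LinearMap.comp_apply,
    LinearMap.adjoint_inner_left, LinearMap.adjoint_inner_left, weightedTranslate_rightRegular,
    weightedTranslate_rightRegular, inner_rightRegular]

/-- The Hilbert–Schmidt bound for `weightedTranslate`. -/
theorem sum_norm_weightedTranslate_sq_le {ι : Type*} [Fintype ι] (w : G → ℂ)
    (e : ι → EuclideanSpace ℂ G) (he : Orthonormal ℂ e) :
    ∑ i, ‖weightedTranslate w (e i)‖ ^ 2 ≤ Fintype.card G * ∑ a, ‖w a‖ ^ 2 := by
  -- The kernel of the operator: evaluation at `x` is pairing with `k x`, so Bessel's inequality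
  -- applies for each `x`.
  let k (x : G) : EuclideanSpace ℂ G := WithLp.toLp 2 fun y => star (w (y * x⁻¹))
  have hk (x : G) (f : EuclideanSpace ℂ G) : ‖weightedTranslate w f x‖ = ‖⟪f, k x⟫_ℂ‖ := by
    rw [norm_inner_symm, weightedTranslate_apply, PiLp.inner_apply]
    congr 1
    refine Fintype.sum_equiv (Equiv.mulRight x) _ _ fun a => ?_
    simp [k, mul_comm]
  have hkn (x : G) : ‖k x‖ ^ 2 = ∑ a, ‖w a‖ ^ 2 := by
    rw [EuclideanSpace.norm_sq_eq]
    exact Fintype.sum_equiv (Equiv.mulRight x⁻¹) _ _ fun a => by simp [k]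
  simp_rw [EuclideanSpace.norm_sq_eq, hk]
  rw [Finset.sum_comm]
  calc _ ≤ ∑ x : G, ∑ a, ‖w a‖ ^ 2 := Finset.sum_le_sum fun x _ => by
        rw [← hkn x]; exact he.sum_inner_products_le (k x)
    _ = _ := by simp

/-- Gowers: let `X` be a product-free set in a finite group `G`, all of whose nonzero spaces of
functions without nonzero invariants have dimension at least `d`. Then `d |X|³ ≤ |G|³`. -/
theorem IsProductFree.mul_card_pow_three_le {d : ℕ}
    (hd : ∀ E : Submodule ℂ (EuclideanSpace ℂ G), E ≠ ⊥ →
      (∀ g, ∀ v ∈ E, rightRegular g v ∈ E) →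
      (∀ v ∈ E, (∀ g, rightRegular g v = v) → v = 0) → d ≤ Module.finrank ℂ E)
    {X : Set G} (hX : IsProductFree X) :
    (d : ℝ) * (X.ncard : ℝ) ^ 3 ≤ (Fintype.card G : ℝ) ^ 3 := by
  classical
  set n : ℝ := (Fintype.card G : ℝ) with hn
  have hnpos : 0 < n := by rw [hn]; exact_mod_cast Fintype.card_pos
  set m : ℝ := (X.ncard : ℝ) with hm
  have hm0 : 0 ≤ m := by positivity
  rcases hm0.eq_or_lt with hmz | hmpos
  · rw [← hmz, zero_pow three_ne_zero, mul_zero]; positivity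
  let χ : G → ℝ := X.indicator 1
  have hχ (a : G) : χ a ^ 2 = χ a := by
    by_cases h : a ∈ X <;> simp [χ, h]
  have hs : ∑ a, χ a = m := by
    simp only [χ, Set.indicator_apply, Pi.one_apply]
    rw [Finset.sum_boole, hm, Set.ncard_eq_toFinset_card']
    congr 2; ext; simp
  let r : G → ℝ := fun a => χ a - m / n
  let w : G → ℂ := fun a => (r a : ℂ)
  have hw0 : ∑ a, w a = 0 := by
    have : ∑ a, r a = 0 := by
      simp only [r, Finset.sum_sub_distrib, hs]
      rw [Finset.sum_const, nsmul_eq_mul, Finset.card_univ, ← hn, mul_div_cancel₀ _ hnpos.ne',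
        sub_self]
    simp only [w]
    exact_mod_cast this
  have hw2 : ∑ a, ‖w a‖ ^ 2 ≤ m := by
    have h (a : G) : ‖w a‖ ^ 2 = χ a - 2 * (m / n) * χ a + (m / n) ^ 2 := by
      rw [Complex.norm_real, Real.norm_eq_abs, sq_abs, ← hχ]
      simp only [r, hχ]
      linear_combination hχ a
    simp only [h, Finset.sum_add_distrib, Finset.sum_sub_distrib, ← Finset.mul_sum, hs]
    rw [Finset.sum_const, nsmul_eq_mul, Finset.card_univ, ← hn]
    have : m - 2 * (m / n) * m + n * (m / n) ^ 2 = m - m ^ 2 / n := by field_simp; ring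
    rw [this]
    exact sub_le_self _ (by positivity)
  set T := weightedTranslate w
  obtain ⟨μ, hμ, hT⟩ := exists_top_singular_value T
  set E := Module.End.eigenspace (LinearMap.adjoint T ∘ₗ T) (μ : ℂ)
  let e : EuclideanSpace ℂ G := WithLp.toLp 2 fun x => (χ x : ℂ)
  have henorm : ‖e‖ ^ 2 = m := by
    rw [EuclideanSpace.norm_sq_eq, ← hs]
    refine Finset.sum_congr rfl fun x _ => ?_
    simp only [e, Complex.norm_real, Real.norm_eq_abs, sq_abs, hχ]
  have hTx (x : G) (hx : x ∈ X) : T e x = (-(m / n * m) : ℝ) := by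
    -- For `x ∈ X`, `a` and `a * x` cannot both lie in `X`, so only the mean term survives.
    have h (a : G) : r a * χ (a * x) = -(m / n * χ (a * x)) := by
      by_cases ha : a ∈ X
      · have : a * x ∉ X := fun h => hX a ha x hx _ h rfl
        simp [χ, this]
      · simp [r, χ, ha]
    have h' : ∑ a, r a * χ (a * x) = -(m / n * m) := by
      simp only [h, Finset.sum_neg_distrib, ← Finset.mul_sum, ← hs]
      congr 2
      exact Fintype.sum_equiv (Equiv.mulRight x) _ _ fun a => rfl
    rw [← h', weightedTranslate_apply]
    simp [w, e]
  have hTe : ⟪e, T e⟫_ℂ = -(m ^ 2 * (m / n) : ℝ) := by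
    have h (x : G) : ⟪e x, T e x⟫_ℂ = ((-(m / n * m) * χ x : ℝ) : ℂ) := by
      by_cases hx : x ∈ X
      · rw [hTx x hx]; simp [e]
      · simp [e, χ, hx]
    rw [PiLp.inner_apply]
    simp only [h]
    rw [← Complex.ofReal_sum, ← Finset.mul_sum, hs]
    push_cast
    ring
  have h1 : m ^ 2 * (m / n) ≤ ‖e‖ * ‖T e‖ := by
    have := norm_inner_le_norm (𝕜 := ℂ) e (T e)
    rwa [hTe, norm_neg, Complex.norm_real, Real.norm_of_nonneg (by positivity)] at this
  have h2 : (m ^ 2 * (m / n)) ^ 2 ≤ μ * m ^ 2 := by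
    calc _ ≤ (‖e‖ * ‖T e‖) ^ 2 := by gcongr
      _ = m * ‖T e‖ ^ 2 := by rw [mul_pow, henorm]
      _ ≤ m * (μ * m) := by rw [← henorm]; gcongr; exact hT e
      _ = _ := by ring
  have hμpos : 0 < μ := by
    have : 0 < (m ^ 2 * (m / n)) ^ 2 := by positivity
    exact pos_of_mul_pos_left (this.trans_le h2) (by positivity)
  have hfix (v) (hv : v ∈ E) (hinv : ∀ g, rightRegular g v = v) : v = 0 := by
    have hTv : T v = 0 := by
      ext x
      have hc (y : G) : v y = v 1 := by
        have := congrArg (fun f : EuclideanSpace ℂ G => f 1) (hinv y)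
        simpa [rightRegular_apply] using this
      rw [weightedTranslate_apply]
      simp only [hc, ← Finset.sum_mul, hw0]
      simp
    have := Module.End.mem_eigenspace_iff.1 hv
    rw [LinearMap.comp_apply, hTv, map_zero, eq_comm, smul_eq_zero] at this
    exact this.resolve_left (by exact_mod_cast hμpos.ne')
  have hdim := hd E hμ (fun g v hv => by
    rw [Module.End.mem_eigenspace_iff] at hv ⊢
    rw [adjoint_comp_rightRegular, hv, map_smul]) hfix
  have hHS : (Module.finrank ℂ E : ℝ) * μ ≤ n * m := by
    let b := stdOrthonormalBasis ℂ E
    have ho : Orthonormal ℂ (fun i => (b i : EuclideanSpace ℂ G)) :=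
      b.orthonormal.comp_linearIsometry E.subtypeₗᵢ
    have hb (i) : ‖T (b i)‖ ^ 2 = μ := by
      have hm := Module.End.mem_eigenspace_iff.1 (b i).2
      have h3 : ⟪T (b i), T (b i)⟫_ℂ = μ := by
        rw [← LinearMap.adjoint_inner_left, ← LinearMap.comp_apply, hm, inner_smul_left,
          inner_self_eq_norm_sq_to_K, ho.1 i]
        simp
      rw [← inner_self_eq_norm_sq (𝕜 := ℂ), h3]
      simp
    calc _ = ∑ i, ‖T (b i)‖ ^ 2 := by simp [hb]
      _ ≤ n * ∑ a, ‖w a‖ ^ 2 := sum_norm_weightedTranslate_sq_le w _ ho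
      _ ≤ _ := by gcongr
  have h4 : (d : ℝ) * μ ≤ n * m := le_trans (by gcongr) hHS
  have h5 : m ^ 4 ≤ μ * n ^ 2 := by
    have : (m ^ 2 * (m / n)) ^ 2 * n ^ 2 = m ^ 4 * m ^ 2 := by field_simp
    have h6 := mul_le_mul_of_nonneg_right h2 (sq_nonneg n)
    rw [this] at h6
    nlinarith [pow_pos hmpos 2]
  have h7 : (d * m ^ 3) * m ≤ n ^ 3 * m := by
    calc _ = d * m ^ 4 := by ring
      _ ≤ d * (μ * n ^ 2) := by gcongr
      _ = (d * μ) * n ^ 2 := by ring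
      _ ≤ n * m * n ^ 2 := by gcongr
      _ = _ := by ring
  exact le_of_mul_le_mul_right h7 hmpos

end Quasirandom

/-! ### Application to `PSL₂(q)` -/

section ProjectiveSpecialLinear

open Matrix Matrix.SpecialLinearGroup

variable {F : Type*} [Field F]

theorem card_specialLinearGroup_two_le [Finite F] :
    Nat.card (SpecialLinearGroup (Fin 2) F) ≤ Nat.card F ^ 3 := by
  classical
  have h3 : Nat.card F ^ 3 = Nat.card (F × F × F) := by
    rw [Nat.card_prod, Nat.card_prod]; ring
  rw [h3]
  refine Nat.card_le_card_of_injective (fun g : SpecialLinearGroup (Fin 2) F =>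
    -- The determinant recovers the missing entry: the lower right one if the upper left is nonzero,
    -- otherwise the upper right one.
    (g.1 0 0, if g.1 0 0 = 0 then g.1 1 1 else g.1 0 1, g.1 1 0)) fun g h hgh => ?_
  have hdet (g : SpecialLinearGroup (Fin 2) F) :
      g.1 0 0 * g.1 1 1 - g.1 0 1 * g.1 1 0 = 1 := by
    rw [← Matrix.det_fin_two]; exact g.2
  have hg := hdet g
  have hh := hdet h
  simp only [Prod.mk.injEq] at hgh
  obtain ⟨h00, hif, h10⟩ := hgh
  rw [h00, h10] at hg
  rw [h00] at hif
  have h01_11 : g.1 0 1 = h.1 0 1 ∧ g.1 1 1 = h.1 1 1 := by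
    by_cases h0 : h.1 0 0 = 0
    · rw [if_pos h0, if_pos h0] at hif
      refine ⟨?_, hif⟩
      have hne : h.1 1 0 ≠ 0 := by
        intro hz; simp [h0, hz] at hh
      refine mul_right_cancel₀ hne ?_
      rw [hif] at hg
      linear_combination hh - hg
    · rw [if_neg h0, if_neg h0] at hif
      refine ⟨hif, mul_left_cancel₀ h0 ?_⟩
      rw [hif] at hg
      linear_combination hg - hh
  ext i j
  fin_cases i <;> fin_cases j
  exacts [h00, h01_11.1, h10, h01_11.2]

/-- Only the trivial transvection is central, so the unipotent group embeds; this makes the orders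
`n` unbounded. -/
theorem card_le_card_projectiveSpecialLinearGroup [Finite F] :
    Nat.card F ≤ Nat.card (ProjectiveSpecialLinearGroup (Fin 2) F) := by
  refine Nat.card_le_card_of_injective (fun x : F =>
    (QuotientGroup.mk (transvection zero_ne_one x) : ProjectiveSpecialLinearGroup (Fin 2) F))
    fun x y hxy => ?_
  have := QuotientGroup.eq.1 hxy
  rw [transvection_inv, ← transvection_add, transvection_mem_center_iff] at this
  exact (neg_add_eq_zero.1 this)

/-- Product-free subsets of `PSL₂(q)` have size at most `2 n^{8/9}`, where `n = |PSL₂(q)|`. -/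
theorem IsProductFree.ncard_le_projectiveSpecialLinearGroup [Finite F]
    {X : Set (ProjectiveSpecialLinearGroup (Fin 2) F)} (hX : IsProductFree X) :
    (X.ncard : ℝ) ≤
      2 * (Nat.card (ProjectiveSpecialLinearGroup (Fin 2) F) : ℝ) ^ (8 / 9 : ℝ) := by
  classical
  have := Fintype.ofFinite (ProjectiveSpecialLinearGroup (Fin 2) F)
  have hq : 2 ≤ Nat.card F := Finite.one_lt_card
  have hn3 : Nat.card (ProjectiveSpecialLinearGroup (Fin 2) F) ≤ Nat.card F ^ 3 :=
    (Nat.card_le_card_of_surjective _ (QuotientGroup.mk'_surjective _)).trans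
      card_specialLinearGroup_two_le
  have hd := IsProductFree.mul_card_pow_three_le (d := Nat.card F / 2) (fun E hE hinv hfix => by
    let ρ : SpecialLinearGroup (Fin 2) F →*
        Module.End ℂ (EuclideanSpace ℂ (ProjectiveSpecialLinearGroup (Fin 2) F)) :=
      rightRegular.comp (QuotientGroup.mk' _)
    have := card_sub_one_le_two_mul_finrank ρ E (fun g v hv => hinv _ v hv) (by
      by_contra! hcon
      refine hE ((Submodule.eq_bot_iff _).2 fun v hv => hfix v hv fun g => ?_)
      obtain ⟨g, rfl⟩ := QuotientGroup.mk'_surjective _ g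
      exact hcon g v hv)
    omega) hX
  rw [← Nat.card_eq_fintype_card] at hd
  set n := Nat.card (ProjectiveSpecialLinearGroup (Fin 2) F)
  set d := Nat.card F / 2
  -- Since `q ≤ 3d`, 27 would do; `512 = 2⁹` yields the constant 2 after a ninth root.
  have hnd : n ≤ 512 * d ^ 3 := by
    have : Nat.card F ≤ 3 * d := by omega
    calc n ≤ Nat.card F ^ 3 := hn3
      _ ≤ (3 * d) ^ 3 := by gcongr
      _ ≤ _ := by rw [mul_pow]; gcongr; norm_num
  have hnd' : (n : ℝ) ≤ 512 * d ^ 3 := by exact_mod_cast hnd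
  have hn : (0 : ℝ) < n := by exact_mod_cast Nat.card_pos
  have hdpos : (0 : ℝ) < d := by
    have : 0 < d := by omega
    exact_mod_cast this
  set m := (X.ncard : ℝ)
  have hm : 0 ≤ m := by positivity
  have h9 : m ^ 9 ≤ 512 * (n : ℝ) ^ 8 := by
    have h1 : (d * m ^ 3) ^ 3 ≤ ((n : ℝ) ^ 3) ^ 3 := by gcongr
    refine le_of_mul_le_mul_left (a := (d : ℝ) ^ 3) ?_ (by positivity)
    calc (d : ℝ) ^ 3 * m ^ 9 = (d * m ^ 3) ^ 3 := by ring
      _ ≤ ((n : ℝ) ^ 3) ^ 3 := h1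
      _ = n * (n : ℝ) ^ 8 := by ring
      _ ≤ 512 * d ^ 3 * (n : ℝ) ^ 8 := by gcongr
      _ = _ := by ring
  refine le_of_pow_le_pow_left₀ (n := 9) (by norm_num) (by positivity) (h9.trans_eq ?_)
  rw [mul_pow, ← Real.rpow_natCast ((n : ℝ) ^ (8 / 9 : ℝ)), ← Real.rpow_mul hn.le]
  norm_num

end ProjectiveSpecialLinear

theorem corollary3p4 :
    (∀ (F : Type*) [Field F] [Finite F]
        (X : Set (Matrix.ProjectiveSpecialLinearGroup (Fin 2) F)), IsProductFree X →
        (X.ncard : ℝ) ≤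
          2 * (Nat.card (Matrix.ProjectiveSpecialLinearGroup (Fin 2) F) : ℝ) ^ (8 / 9 : ℝ)) ∧
    ¬ ∃ c : ℝ, 0 < c ∧ ∀ (G : Type) [Group G] [Finite G] [Nontrivial G],
        ∃ X : Set G, IsProductFree X ∧ c * (Nat.card G : ℝ) ≤ (X.ncard : ℝ) := by
  refine ⟨fun F _ _ X hX => hX.ncard_le_projectiveSpecialLinearGroup, ?_⟩
  rintro ⟨c, hc, h⟩
  -- A density `c` would give `c⁹ n ≤ 2⁹`, which fails once `n ≥ p ≥ N`.
  obtain ⟨N, hN⟩ := exists_nat_gt ((2 / c) ^ 9)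
  obtain ⟨p, hpN, hp⟩ := Nat.exists_infinite_primes N
  have : Fact p.Prime := ⟨hp⟩
  have hcard := card_le_card_projectiveSpecialLinearGroup (F := ZMod p)
  rw [Nat.card_zmod] at hcard
  have : Nontrivial (Matrix.ProjectiveSpecialLinearGroup (Fin 2) (ZMod p)) :=
    Finite.one_lt_card_iff_nontrivial.1 (hp.one_lt.trans_le hcard)
  obtain ⟨X, hX, hle⟩ := h (Matrix.ProjectiveSpecialLinearGroup (Fin 2) (ZMod p))
  have hup := hle.trans hX.ncard_le_projectiveSpecialLinearGroup
  set n := Nat.card (Matrix.ProjectiveSpecialLinearGroup (Fin 2) (ZMod p))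
  have hn : (0 : ℝ) < n := by exact_mod_cast hp.pos.trans_le hcard
  have hNn : (N : ℝ) ≤ n := by exact_mod_cast hpN.trans hcard
  have h9 : (c * n) ^ 9 ≤ (2 * (n : ℝ) ^ (8 / 9 : ℝ)) ^ 9 := by gcongr
  rw [mul_pow, mul_pow, ← Real.rpow_natCast ((n : ℝ) ^ (8 / 9 : ℝ)), ← Real.rpow_mul hn.le,
    show (8 / 9 : ℝ) * (9 : ℕ) = (8 : ℕ) by norm_num, Real.rpow_natCast, pow_succ (n : ℝ),
    mul_comm ((n : ℝ) ^ 8), ← mul_assoc] at h9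
  have h10 := le_of_mul_le_mul_right h9 (by positivity)
  rw [div_pow, div_lt_iff₀ (by positivity)] at hN
  nlinarith [pow_pos hc 9]
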